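/- Let $n\ge 1$, $N=2n+1$, and let $\mathbb H^n=\mathbb R^n\times\mathbb R^n\times\mathbb R$ be the Heisenberg group with group law $$(x,y,t)\cdot(x',y',t')=\Big(x+x',\,y+y',\,t+t'+2\sum_{j=1}^n(x'_jy_j-x_jy'_j)\Big),$$ dilations $\delta_\varepsilon(x,y,t)=(\varepsilon x,\varepsilon y,\varepsilon^2t)$, Lebesgue measure, and left-invariant vector fields $X_j=\partial_{x_j}+2y_j\partial_t$, $Y_j=\partial_{y_j}-2x_j\partial_t$ ($1\le j\le n$), $T=\partial_t$; write $Z_j=X_j$, $Z_{n+j}=Y_j$. For $w=(x,y,t)\in\mathbb H^n$ put $w_{\mathcal H}=(x,y)\in\mathbb R^{2n}$ and $w_N=t$. Let $d$ be the Carnot–Carathéodory distance, i.e. $d(p,q)$ is the infimum of the lengths of absolutely continuous curves $\gamma:[0,1]\to\mathbb H^n$ from $p$ to $q$ with $\dot\gamma(\tau)\in\mathrm{span}\{Z_1,\dots,Z_{2n}\}(\gamma(\tau))$ for a.e. $\tau$, the length being taken in the Riemannian metric that makes $X_1,\dots,X_n,Y_1,\dots,Y_n,T$ orthonormal; $\mathrm{dist}$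 denotes the corresponding distance between sets (equal to $+\infty$ if one of them is empty). For $\Omega\subseteq\mathbb H^n$ open and $s\in[1,\infty]$, $W^{1,s}_{\mathcal H}(\Omega)$ is the space of $f\in L^s(\Omega)$ whose distributional derivatives $Z_jf$, defined by $\langle Z_jf,\varphi\rangle=-\int_\Omega f\,Z_j\varphi\,dp$ for $\varphi\in C^\infty_c(\Omega)$, belong to $L^s(\Omega)$ for $j=1,\dots,2n$; and $\nabla^{\mathcal H}f=(Z_1f,\dots,Z_{2n}f)$. **Theorem.** Let $s\in[1,\infty)$, let $\Omega\subseteq\mathbb H^n$ be open, let $f\in W^{1,s}_{\mathcal H}(\Omega)$, and let $A\subseteq\Omega$ be open with $\mathrm{dist}(A,\partial\Omega)>0$. Then, for every $w\in\mathbb H^n$, as $\varepsilon\searrow0$, $$\frac{f(p\cdot\delta_\varepsilon(w))-f(p)}{\varepsilon}\longrightarrow\langle\nabla^{\mathcal H}f(p),w_{\mathcal H}\rangle\qquad\text{in }L^s(A)\text{ (as functions of }p).$$ In addition, if $w\in\mathbb H^n$ and $\varepsilon>0$ satisfy $\varepsilon\big(|w_{\mathcal H}|+2\sqrt{|w_N|}\big)<\mathrm{dist}(A,\partial\Omega)$,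 then $p\cdot\delta_\varepsilon(w)\in\Omega$ for every $p\in A$, the difference quotient belongs to $L^s(A)$, and $$\left\|\frac{f(p\cdot\delta_\varepsilon(w))-f(p)}{\varepsilon}\right\|_{L^s(A)}\le\big(|w_{\mathcal H}|+2\sqrt{|w_N|}\big)\,\|\nabla^{\mathcal H}f\|_{L^s(\Omega)}.$$ -/

import Mathlib

open MeasureTheory Filter Topology
open scoped ENNReal

noncomputable section

namespace Heisenberg

/-- The space `ℝ^{2n}` of horizontal components: `Sum.inl j` indexes `x_j`, `Sum.inr j`
indexes `y_j`. -/
abbrev Hor (n : ℕ) : Type := EuclideanSpace ℝ (Fin n ⊕ Fin n)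

/-- The underlying space `ℝ^{2n+1}` of the `n`-th Heisenberg group; a point `p = (x, y, t)` has
horizontal part `p.1 = (x, y)` and vertical part `p.2 = t`. Its `volume` is the Lebesgue measure. -/
abbrev Heis (n : ℕ) : Type := Hor n × ℝ

variable {n : ℕ}

/-- The group law
`(x,y,t) · (x',y',t') = (x + x', y + y', t + t' + 2 ∑ j, (x'_j y_j - x_j y'_j))`. -/
def mul (p q : Heis n) : Heis n :=
  (p.1 + q.1,
    p.2 + q.2 + 2 * ∑ j : Fin n,
      (q.1 (Sum.inl j) * p.1 (Sum.inr j) - p.1 (Sum.inl j) * q.1 (Sum.inr j)))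

/-- The intrinsic dilations `δ_r (x,y,t) = (r x, r y, r² t)`. -/
def dil (r : ℝ) (p : Heis n) : Heis n := (r • p.1, r ^ 2 * p.2)

/-- The coefficient of `∂_t` in `Z_j(p)`: `2 y_j` for `X_j`, and `- 2 x_j` for `Y_j`. -/
def vertCoeff (j : Fin n ⊕ Fin n) (p : Heis n) : ℝ :=
  match j with
  | Sum.inl i => 2 * p.1 (Sum.inr i)
  | Sum.inr i => -(2 * p.1 (Sum.inl i))

/-- The horizontal left-invariant vector fields: `Z (Sum.inl j) = X_j = ∂_{x_j} + 2 y_j ∂_t` and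
`Z (Sum.inr j) = Y_j = ∂_{y_j} - 2 x_j ∂_t`. -/
def Z (j : Fin n ⊕ Fin n) (p : Heis n) : Heis n :=
  (EuclideanSpace.single j 1, vertCoeff j p)

/-- The action `Z_j φ` of `Z_j` on a differentiable function. -/
def ZDeriv (j : Fin n ⊕ Fin n) (φ : Heis n → ℝ) (p : Heis n) : ℝ := fderiv ℝ φ p (Z j p)

/-- The horizontal distribution at `p`. -/
def horizontalSpace (p : Heis n) : Submodule ℝ (Heis n) :=
  Submodule.span ℝ (Set.range fun j => Z j p)

/-- The component along `T = ∂_t` of a tangent vector `v` at `p`, in the left-invariant frame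
`X_1, …, X_n, Y_1, …, Y_n, T`; the components along `X_j`, `Y_j` are the coordinates of `v.1`. -/
def tComponent (p v : Heis n) : ℝ := v.2 - ∑ j, v.1 j * vertCoeff j p

/-- The left-invariant Riemannian metric for which `X_1, …, X_n, Y_1, …, Y_n, T` is
orthonormal. -/
def metric (p v v' : Heis n) : ℝ := inner ℝ v.1 v'.1 + tComponent p v * tComponent p v'

/-- Absolutely continuous horizontal curves `γ : [0,1] → ℍⁿ` (values outside `[0,1]` are
irrelevant). -/
def IsHorizontalCurve (γ : ℝ → Heis n) : Prop :=
  AbsolutelyContinuousOnInterval γ 0 1 ∧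
    ∀ᵐ τ ∂(volume.restrict (Set.Icc (0 : ℝ) 1)), deriv γ τ ∈ horizontalSpace (γ τ)

/-- The length of a curve `γ : [0,1] → ℍⁿ`. -/
def curveLength (γ : ℝ → Heis n) : ℝ≥0∞ :=
  ∫⁻ τ in Set.Icc (0 : ℝ) 1, ENNReal.ofReal (√(metric (γ τ) (deriv γ τ) (deriv γ τ)))

/-- The Carnot–Carathéodory distance. -/
def ccDist (p q : Heis n) : ℝ≥0∞ :=
  ⨅ (γ : ℝ → Heis n) (_ : IsHorizontalCurve γ) (_ : γ 0 = p) (_ : γ 1 = q), curveLength γ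

/-- The Carnot–Carathéodory distance between two sets, equal to `∞` if one of them is empty. -/
def ccSetDist (S S' : Set (Heis n)) : ℝ≥0∞ := ⨅ p ∈ S, ⨅ q ∈ S', ccDist p q

/-- On the open set `Ω`, the distribution `Z_j u` is represented by the locally integrable
function `g`. -/
def IsWeakZDeriv (Ω : Set (Heis n)) (j : Fin n ⊕ Fin n) (u g : Heis n → ℝ) : Prop :=
  LocallyIntegrableOn u Ω volume ∧ LocallyIntegrableOn g Ω volume ∧
    ∀ φ : Heis n → ℝ, ContDiff ℝ ((⊤ : ℕ∞) : WithTop ℕ∞) φ → HasCompactSupport φ →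
      tsupport φ ⊆ Ω → ∫ p in Ω, g p * φ p = -∫ p in Ω, u p * ZDeriv j φ p

/-- `G` represents the weak horizontal gradient `(X_1 u, …, X_n u, Y_1 u, …, Y_n u)` on `Ω`. -/
def IsWeakHorizontalGradient (Ω : Set (Heis n)) (u : Heis n → ℝ) (G : Heis n → Hor n) : Prop :=
  ∀ j, IsWeakZDeriv Ω j u fun p => G p j

/-- Membership in the horizontal Sobolev space `W^{1,s}_H(Ω)`. -/
def MemHorizontalSobolev (s : ℝ≥0∞) (Ω : Set (Heis n)) (u : Heis n → ℝ) : Prop :=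
  MemLp u s (volume.restrict Ω) ∧
    ∀ j, ∃ g : Heis n → ℝ, MemLp g s (volume.restrict Ω) ∧ IsWeakZDeriv Ω j u g

/-- The first-order intrinsic difference quotient `p ↦ (f (p · δ_ε w) - f p) / ε`. -/
def diffQuot (f : Heis n → ℝ) (w : Heis n) (ε : ℝ) (p : Heis n) : ℝ :=
  (f (mul p (dil ε w)) - f p) / ε

end Heisenberg

end

/-! The flow of the left-invariant horizontal field with coordinates `v` is the right translation `p
↦ p · exp(τv)`. It preserves Lebesgue measure and commutes with the field that generates it. Testing
a weak derivative against functions transported by this flow therefore gives the fundamental theorem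
of calculus `ae_sub_eq_integral_flow`: almost everywhere, the increment of `F` along a segment that
stays in `Ω` is the average over `τ ∈ [0,1]` of `⟨G(p · exp(τv)), v⟩`.

A general `w` is reached from the origin by five horizontal segments (`exists_endpoint_eq`): one
with velocity `w_H`, then a closed square in one `(x_i, y_i)` plane whose enclosed area produces the
vertical component. Their total length is `|w_H| + 2√|w_N|`, and dilation by `ε` multiplies it by
`ε`. A path from a point of `A` shorter than the distance to `∂Ω` cannot leave `Ω`
(`pathIn_of_length_lt`).

Telescoping over the segments proves both claims. Averaging does not increase `L^s` norms, so each
segment costs at most its length times the norm of the gradient (`eLpNorm_sub_le_of_pathIn`). For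
the limit, continuity of right translations in `L^s` allows every translated gradient to be replaced
by the one at `p`; the velocities add up to `w_H`, since those of the square cancel
(`exists_modulus_of_pathIn`). -/

noncomputable section

namespace Heisenberg

variable {n : ℕ}

/-! ### Group structure and right translations -/

/-- The symplectic form on `ℝ^{2n}` that appears in the group law. -/
def symp (u v : Hor n) : ℝ :=
  2 * ∑ j : Fin n, (v (Sum.inl j) * u (Sum.inr j) - u (Sum.inl j) * v (Sum.inr j))

lemma symp_add_left (u u' v : Hor n) : symp (u + u') v = symp u v + symp u' v := by
  simp only [symp, ← mul_add, ← Finset.sum_add_distrib, PiLp.add_apply]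
  congr 1
  exact Finset.sum_congr rfl fun j _ => by ring

lemma symp_neg_swap (u v : Hor n) : symp v u = -symp u v := by
  simp only [symp, ← mul_neg, ← Finset.sum_neg_distrib]
  congr 1
  exact Finset.sum_congr rfl fun j _ => by ring

lemma symp_add_right (u v v' : Hor n) : symp u (v + v') = symp u v + symp u v' := by
  rw [symp_neg_swap, symp_add_left, symp_neg_swap u v, symp_neg_swap u v']
  ring

lemma symp_smul_left (c : ℝ) (u v : Hor n) : symp (c • u) v = c * symp u v := by
  simp only [symp, Finset.mul_sum, PiLp.smul_apply, smul_eq_mul]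
  exact Finset.sum_congr rfl fun j _ => by ring

lemma symp_smul_right (c : ℝ) (u v : Hor n) : symp u (c • v) = c * symp u v := by
  rw [symp_neg_swap, symp_smul_left, symp_neg_swap u v]
  ring

lemma symp_neg_left (u v : Hor n) : symp (-u) v = -symp u v := by
  simpa using symp_smul_left (-1) u v

lemma symp_neg_right (u v : Hor n) : symp u (-v) = -symp u v := by
  simpa using symp_smul_right (-1) u v

@[simp] lemma symp_self (u : Hor n) : symp u u = 0 := by
  have := symp_neg_swap u u
  linarith

@[simp] lemma symp_zero_left (u : Hor n) : symp 0 u = 0 := by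
  simpa using symp_smul_left 0 u u

@[simp] lemma symp_zero_right (u : Hor n) : symp u 0 = 0 := by
  simpa using symp_smul_right 0 u u

@[fun_prop]
lemma contDiff_symp {E : Type*} [NormedAddCommGroup E] [NormedSpace ℝ E] {k : WithTop ℕ∞}
    {a b : E → Hor n} (ha : ContDiff ℝ k a) (hb : ContDiff ℝ k b) :
    ContDiff ℝ k fun x => symp (a x) (b x) := by
  rw [contDiff_euclidean] at ha hb
  unfold symp
  exact contDiff_const.mul (ContDiff.sum fun j _ =>
    ((hb _).mul (ha _)).sub ((ha _).mul (hb _)))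

@[fun_prop]
lemma continuous_symp {X : Type*} [TopologicalSpace X] {a b : X → Hor n} (ha : Continuous a)
    (hb : Continuous b) : Continuous fun x => symp (a x) (b x) := by
  unfold symp
  fun_prop

lemma mul_def (p q : Heis n) : mul p q = (p.1 + q.1, p.2 + q.2 + symp p.1 q.1) := rfl

lemma mul_assoc' (p q r : Heis n) : mul (mul p q) r = mul p (mul q r) := by
  simp only [mul_def, symp_add_left, symp_add_right]
  ext1
  · exact add_assoc _ _ _
  · simp only
    ring

@[simp] lemma mul_zero' (p : Heis n) : mul p 0 = p := by
  simp [mul_def]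

@[simp] lemma mul_neg_cancel_right' (p q : Heis n) : mul (mul p q) (-q) = p := by
  ext1
  · simp [mul_def]
  · simp only [mul_def, Prod.fst_neg, Prod.snd_neg, symp_neg_right, symp_add_left, symp_self]
    ring

@[simp] lemma neg_mul_cancel_right' (p q : Heis n) : mul (mul p (-q)) q = p := by
  simpa using mul_neg_cancel_right' p (-q)

@[fun_prop]
lemma continuous_mul_fun {X : Type*} [TopologicalSpace X] {a b : X → Heis n} (ha : Continuous a)
    (hb : Continuous b) : Continuous fun x => mul (a x) (b x) := by
  simp only [mul_def]
  fun_prop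

lemma contDiff_mul_right (q : Heis n) {k : WithTop ℕ∞} : ContDiff ℝ k fun p => mul p q := by
  simp only [mul_def]
  fun_prop

/-- Right translations as homeomorphisms. -/
def rightMul (q : Heis n) : Heis n ≃ₜ Heis n where
  toFun p := mul p q
  invFun p := mul p (-q)
  left_inv p := by simp
  right_inv p := by simp
  continuous_toFun := by fun_prop
  continuous_invFun := by fun_prop

/-- Right translation is a skew product: a translation of the horizontal part, and over each
horizontal point a translation of the vertical line. -/
lemma measurePreserving_mul_right (q : Heis n) :
    MeasurePreserving (fun p : Heis n => mul p q) volume volume := by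
  rw [Measure.volume_eq_prod]
  refine MeasurePreserving.skew_product (g := fun x t => t + q.2 + symp x q.1)
    (measurePreserving_add_right volume q.1) ?_ (ae_of_all _ fun x => ?_)
  · exact Continuous.measurable (by unfold Function.uncurry; fun_prop)
  · simpa only [add_assoc] using (measurePreserving_add_right volume (q.2 + symp x q.1)).map_eq

lemma measurableEmbedding_mul_right (q : Heis n) :
    MeasurableEmbedding fun p : Heis n => mul p q :=
  (rightMul q).measurableEmbedding

/-- The exponential of the horizontal left-invariant vector field with coordinates `v`. -/
def hexp (v : Hor n) : Heis n := (v, 0)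

@[fun_prop]
lemma continuous_hexp {X : Type*} [TopologicalSpace X] {a : X → Hor n} (ha : Continuous a) :
    Continuous fun x => hexp (a x) := by
  unfold hexp
  fun_prop

@[simp] lemma hexp_zero : hexp (0 : Hor n) = 0 := rfl

lemma hexp_neg (v : Hor n) : hexp (-v) = -hexp v := by
  simp [hexp]

lemma mul_hexp (p : Heis n) (v : Hor n) : mul p (hexp v) = p + (v, symp p.1 v) := by
  simp [mul_def, hexp, Prod.ext_iff]

lemma mul_hexp_smul (p : Heis n) (c : ℝ) (v : Hor n) :
    mul p (hexp (c • v)) = p + c • (v, symp p.1 v) := by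
  rw [mul_hexp, symp_smul_right]
  rfl

/-! ### Continuity of translations and averages in `L^s` -/

/-- Right translation is continuous in `L^s`. -/
lemma tendsto_eLpNorm_mul_right_sub {E : Type*} [NormedAddCommGroup E] {s : ℝ≥0∞} (hs : 1 ≤ s)
    (hs' : s ≠ ∞) {g : Heis n → E} (hg : MemLp g s volume) :
    Tendsto (fun q : Heis n => eLpNorm (fun p => g (mul p q) - g p) s volume) (𝓝 0) (𝓝 0) := by
  have : Fact (1 ≤ s) := ⟨hs⟩
  let Φ : C(Heis n, C(Heis n, Heis n)) :=
    ContinuousMap.curry ⟨fun z : Heis n × Heis n => mul z.2 z.1, by fun_prop⟩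
  have hΦ : ∀ q, MeasurePreserving (Φ q) volume volume := measurePreserving_mul_right
  have h := Filter.Tendsto.compMeasurePreservingLp (f := fun _ : Heis n => hg.toLp g)
    (g := Φ) (l := 𝓝 0) (g₀ := Φ 0) tendsto_const_nhds Φ.continuous.continuousAt hΦ (hΦ 0) hs'
  rw [tendsto_iff_edist_tendsto_0] at h
  refine h.congr fun q => ?_
  rw [Lp.edist_def]
  refine eLpNorm_congr_ae ?_
  have key : ∀ q, Lp.compMeasurePreserving (Φ q) (hΦ q) (hg.toLp g)
      =ᵐ[volume] fun p => g (mul p q) := fun q =>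
    (Lp.coeFn_compMeasurePreserving _ (hΦ q)).trans
      ((hΦ q).quasiMeasurePreserving.ae_eq_comp hg.coeFn_toLp)
  filter_upwards [key q, key 0] with p hp hp0
  rw [Pi.sub_apply, hp, hp0, mul_zero']

section Averages

variable {X T : Type*} [MeasurableSpace X] [MeasurableSpace T] {μ : Measure X} [SFinite μ]
  {ν : Measure T} [IsProbabilityMeasure ν] {s : ℝ≥0∞} {H : X → T → ℝ} {C : ℝ≥0∞}

/-- Tonelli: integrate in `x` first, then use that `ν` has mass one. -/
lemma lintegral_lintegral_rpow_enorm_le (hs : 1 ≤ s) (hs' : s ≠ ∞)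
    (hH : Measurable fun z : X × T => H z.1 z.2)
    (hC : ∀ᵐ τ ∂ν, eLpNorm (fun x => H x τ) s μ ≤ C) :
    ∫⁻ x, ∫⁻ τ, ‖H x τ‖ₑ ^ s.toReal ∂ν ∂μ ≤ C ^ s.toReal := by
  have hs0 : s ≠ 0 := (zero_lt_one.trans_le hs).ne'
  have hr : 0 < s.toReal := ENNReal.toReal_pos hs0 hs'
  have hC' : ∀ᵐ τ ∂ν, ∫⁻ x, ‖H x τ‖ₑ ^ s.toReal ∂μ ≤ C ^ s.toReal := by
    filter_upwards [hC] with τ hτ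
    rwa [eLpNorm_eq_lintegral_rpow_enorm_toReal hs0 hs', one_div,
      ENNReal.rpow_inv_le_iff hr] at hτ
  calc ∫⁻ x, ∫⁻ τ, ‖H x τ‖ₑ ^ s.toReal ∂ν ∂μ
      = ∫⁻ τ, ∫⁻ x, ‖H x τ‖ₑ ^ s.toReal ∂μ ∂ν :=
        lintegral_lintegral_swap (hH.enorm.pow_const _).aemeasurable
    _ ≤ ∫⁻ _, C ^ s.toReal ∂ν := lintegral_mono_ae hC'
    _ = C ^ s.toReal := by simp

/-- Averaging does not increase the `L^s` norm. -/
lemma eLpNorm_integral_le (hs : 1 ≤ s) (hs' : s ≠ ∞) (hH : Measurable fun z : X × T => H z.1 z.2)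
    (hC : ∀ᵐ τ ∂ν, eLpNorm (fun x => H x τ) s μ ≤ C) :
    eLpNorm (fun x => ∫ τ, H x τ ∂ν) s μ ≤ C := by
  have hs0 : s ≠ 0 := (zero_lt_one.trans_le hs).ne'
  have hr : 0 < s.toReal := ENNReal.toReal_pos hs0 hs'
  rw [eLpNorm_eq_lintegral_rpow_enorm_toReal hs0 hs', one_div, ENNReal.rpow_inv_le_iff hr]
  refine (lintegral_mono fun x => ?_).trans (lintegral_lintegral_rpow_enorm_le hs hs' hH hC)
  have hm : Measurable fun τ => H x τ := hH.comp (measurable_prodMk_left (x := x))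
  -- Jensen on the probability space `ν`: the `L^1` norm in `τ` is at most the `L^s` norm.
  have h1 := eLpNorm_le_eLpNorm_of_exponent_le (μ := ν) hs hm.aestronglyMeasurable
  rw [eLpNorm_one_eq_lintegral_enorm, eLpNorm_eq_lintegral_rpow_enorm_toReal hs0 hs',
    one_div, ENNReal.le_rpow_inv_iff hr] at h1
  exact (ENNReal.rpow_le_rpow (enorm_integral_le_lintegral_enorm _) hr.le).trans h1

/-- The double integral is finite, so almost every slice is in `L^s(ν)`, hence in `L^1(ν)` because
`ν` is finite. -/
lemma ae_integrable_of_eLpNorm_le (hs : 1 ≤ s) (hs' : s ≠ ∞)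
    (hH : Measurable fun z : X × T => H z.1 z.2) (hCtop : C ≠ ∞)
    (hC : ∀ᵐ τ ∂ν, eLpNorm (fun x => H x τ) s μ ≤ C) :
    ∀ᵐ x ∂μ, Integrable (fun τ => H x τ) ν := by
  have hs0 : s ≠ 0 := (zero_lt_one.trans_le hs).ne'
  have hlt := (lintegral_lintegral_rpow_enorm_le hs hs' hH hC).trans_lt
    (ENNReal.rpow_lt_top_of_nonneg ENNReal.toReal_nonneg hCtop)
  filter_upwards [ae_lt_top (hH.enorm.pow_const _).lintegral_prod_right' hlt.ne] with x hx
  have hm : Measurable fun τ => H x τ := hH.comp (measurable_prodMk_left (x := x))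
  have : MemLp (fun τ => H x τ) s ν :=
    ⟨hm.aestronglyMeasurable, (eLpNorm_lt_top_iff_lintegral_rpow_enorm_lt_top hs0 hs').2 hx⟩
  exact this.integrable hs

end Averages

/-! ### Horizontal curves and the Carnot–Carathéodory distance -/

lemma sum_mul_vertCoeff (p : Heis n) (v : Hor n) : ∑ j, v j * vertCoeff j p = symp p.1 v := by
  simp only [symp, vertCoeff, Fintype.sum_sum_type, Finset.mul_sum, ← Finset.sum_add_distrib]
  exact Finset.sum_congr rfl fun j _ => by ring

lemma sum_smul_Z (p : Heis n) (v : Hor n) : ∑ j, v j • Z j p = (v, symp p.1 v) := by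
  ext1
  · rw [Prod.fst_sum]
    ext i
    simp [Z, Finset.sum_apply, Pi.single_apply, -Fintype.sum_sum_type]
  · rw [Prod.snd_sum, ← sum_mul_vertCoeff]
    rfl

lemma mem_horizontalSpace (p : Heis n) (v : Hor n) : (v, symp p.1 v) ∈ horizontalSpace p := by
  rw [← sum_smul_Z]
  exact Submodule.sum_mem _ fun j _ =>
    Submodule.smul_mem _ _ (Submodule.subset_span ⟨j, rfl⟩)

lemma sqrt_metric_horizontal (p : Heis n) (v : Hor n) :
    √(metric p (v, symp p.1 v) (v, symp p.1 v)) = ‖v‖ := by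
  simp [metric, tComponent, sum_mul_vertCoeff, -Fintype.sum_sum_type]

lemma sqrt_metric_smul (p v : Heis n) (c : ℝ) :
    √(metric p (c • v) (c • v)) = |c| * √(metric p v v) := by
  have : metric p (c • v) (c • v) = c ^ 2 * metric p v v := by
    have h : tComponent p (c • v) = c * tComponent p v := by
      simp only [tComponent, sum_mul_vertCoeff, Prod.smul_fst, Prod.smul_snd, symp_smul_right,
        smul_eq_mul]
      ring
    simp only [metric, h, Prod.smul_fst, inner_smul_left, inner_smul_right]
    simp
    ring
  rw [this, Real.sqrt_mul (sq_nonneg c), Real.sqrt_sq_eq_abs]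

/-- `q` can be reached from `p` along a Lipschitz horizontal curve of length at most `L`. -/
def Reaches (p q : Heis n) (L : ℝ≥0∞) : Prop :=
  ∃ (γ : ℝ → Heis n) (K : NNReal), LipschitzWith K γ ∧
    (∀ᵐ τ ∂(volume.restrict (Set.Icc (0 : ℝ) 1)), deriv γ τ ∈ horizontalSpace (γ τ)) ∧
    γ 0 = p ∧ γ 1 = q ∧ curveLength γ ≤ L

/-- Lipschitz curves are absolutely continuous. The Lipschitz class suffices here and passes easily
through concatenation. -/
lemma Reaches.ccDist_le {p q : Heis n} {L : ℝ≥0∞} (h : Reaches p q L) : ccDist p q ≤ L := by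
  obtain ⟨γ, K, hK, hγ, h0, h1, hL⟩ := h
  exact (iInf₂_le_of_le γ ⟨(hK.lipschitzOnWith (s := _)).absolutelyContinuousOnInterval, hγ⟩
    (iInf₂_le_of_le h0 h1 le_rfl)).trans hL

lemma reaches_refl (p : Heis n) : Reaches p p 0 := by
  refine ⟨fun _ => p, 0, LipschitzWith.const p, ?_, rfl, rfl, ?_⟩
  · simp
  · simp [curveLength, metric, tComponent]

lemma ae_restrict_Icc_half_comp {P : ℝ → Prop}
    (h : ∀ᵐ τ ∂(volume.restrict (Set.Icc (0 : ℝ) 1)), P τ) :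
    ∀ᵐ τ : ℝ, τ ∈ Set.Icc (0 : ℝ) (1 / 2) → P (2 * τ) := by
  rw [ae_restrict_iff' measurableSet_Icc] at h
  have hq : Measure.QuasiMeasurePreserving (fun τ : ℝ => 2 * τ) volume volume := by
    refine ⟨by fun_prop, ?_⟩
    rw [Real.map_volume_mul_left two_ne_zero]
    exact Measure.smul_absolutelyContinuous
  filter_upwards [hq.ae h] with τ hτ h2
  exact hτ ⟨by linarith [h2.1], by linarith [h2.2]⟩

/-- A horizontal curve can be continued along a horizontal segment. -/
lemma Reaches.mul_hexp {p q : Heis n} {L : ℝ≥0∞} (h : Reaches p q L) (v : Hor n) :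
    Reaches p (mul q (hexp v)) (L + ENNReal.ofReal ‖v‖) := by
  obtain ⟨γ, K, hK, hγ, h0, h1, hL⟩ := h
  set u : Heis n := (v, symp q.1 v) with hu
  -- `γ` is run at double speed on `[0, 1/2]`, then the segment on `[1/2, 1]`. The clamped formula
  -- makes `c` visibly Lipschitz, with no gluing at the junction.
  let c : ℝ → Heis n := fun τ => γ (min (2 * τ) 1) + max (2 * τ - 1) 0 • u
  have hlow : ∀ τ : ℝ, τ < 1 / 2 → c τ = γ (2 * τ) ∧ deriv c τ = (2 : ℝ) • deriv γ (2 * τ) := by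
    have hc : ∀ τ : ℝ, τ < 1 / 2 → c τ = γ (2 * τ) := fun τ hτ => by
      simp only [c]
      rw [min_eq_left (by linarith), max_eq_right (by linarith), zero_smul, add_zero]
    refine fun τ hτ => ⟨hc τ hτ, ?_⟩
    rw [← deriv_comp_mul_left]
    exact Filter.EventuallyEq.deriv_eq ((eventually_lt_nhds hτ).mono hc)
  have hhigh : ∀ τ : ℝ, 1 / 2 < τ → c τ = q + (2 * τ - 1) • u ∧ deriv c τ = (2 : ℝ) • u := by
    have hc : ∀ τ : ℝ, 1 / 2 < τ → c τ = q + (2 * τ - 1) • u := fun τ hτ => by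
      simp only [c]
      rw [min_eq_right (by linarith), max_eq_left (by linarith), h1]
    refine fun τ hτ => ⟨hc τ hτ, ?_⟩
    rw [Filter.EventuallyEq.deriv_eq ((eventually_gt_nhds hτ).mono hc)]
    have : HasDerivAt (fun τ : ℝ => 2 * τ - 1) 2 τ := by
      simpa using ((hasDerivAt_id τ).const_mul 2).sub_const 1
    exact ((this.smul_const u).const_add q).deriv
  -- Since `symp v v = 0`, the constant velocity `u` stays horizontal at every point of the segment.
  have hu' : ∀ τ : ℝ, u = (v, symp (q + (2 * τ - 1) • u).1 v) := fun τ => by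
    simp [hu, symp_add_left, symp_smul_left]
  have hae : ∀ᵐ τ : ℝ, τ ≠ 1 / 2 := by simp [ae_iff]
  obtain ⟨K', hK'⟩ : ∃ K', LipschitzWith K' c := by
    have hl : LipschitzWith 2 fun τ : ℝ => 2 * τ := by
      simpa using (lipschitzWith_smul (β := ℝ) (2 : ℝ))
    have e1 := hK.comp (hl.min_const 1)
    have e2 := ((hl.sub (LipschitzWith.const (1 : ℝ))).max_const 0)
    have e3 : LipschitzWith ‖u‖₊ fun τ : ℝ => τ • u := by
      refine LipschitzWith.of_dist_le_mul fun x y => ?_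
      rw [dist_eq_norm, ← sub_smul, norm_smul, dist_eq_norm, mul_comm]
      rfl
    exact ⟨_, e1.add (e3.comp e2)⟩
  refine ⟨c, K', hK', ?_, ?_, ?_, ?_⟩
  · rw [ae_restrict_iff' measurableSet_Icc]
    filter_upwards [hae, ae_restrict_Icc_half_comp hγ] with τ hτ hγτ hI
    rcases lt_or_gt_of_ne hτ with hlt | hgt
    · rw [(hlow τ hlt).1, (hlow τ hlt).2]
      exact Submodule.smul_mem _ _ (hγτ ⟨hI.1, hlt.le⟩)
    · rw [(hhigh τ hgt).1, (hhigh τ hgt).2]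
      refine Submodule.smul_mem _ _ ?_
      nth_rewrite 2 [hu' τ]
      exact mem_horizontalSpace _ v
  · rw [(hlow 0 (by norm_num)).1, mul_zero, h0]
  · rw [(hhigh 1 (by norm_num)).1, Heisenberg.mul_hexp]
    norm_num [hu]
  · have hsplit : Set.Icc (0 : ℝ) 1 = Set.Icc 0 (1 / 2) ∪ Set.Ioc (1 / 2) 1 :=
      (Set.Icc_union_Ioc_eq_Icc (by norm_num) (by norm_num)).symm
    have hA : ∫⁻ τ in Set.Icc (0 : ℝ) (1 / 2),
        ENNReal.ofReal (√(metric (c τ) (deriv c τ) (deriv c τ))) = curveLength γ := by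
      -- The doubled speed is exactly the Jacobian of `τ ↦ 2τ`.
      have himg : (fun τ : ℝ => 2 * τ) '' Set.Icc 0 (1 / 2) = Set.Icc 0 1 := by
        rw [Set.image_mul_left_Icc (by norm_num) (by norm_num)]
        norm_num
      rw [curveLength, ← himg, lintegral_image_eq_lintegral_abs_deriv_mul measurableSet_Icc
        (f' := fun _ => 2)
        (fun x _ => by simpa using ((hasDerivAt_id x).const_mul 2).hasDerivWithinAt)
        (fun x _ y _ hxy => by simpa using hxy)]
      refine setLIntegral_congr_fun_ae measurableSet_Icc ?_
      filter_upwards [hae] with τ hτ hI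
      have hlt := lt_of_le_of_ne hI.2 hτ
      rw [(hlow τ hlt).1, (hlow τ hlt).2, sqrt_metric_smul, ENNReal.ofReal_mul (abs_nonneg _)]
    have hB : ∫⁻ τ in Set.Ioc (1 / 2 : ℝ) 1,
        ENNReal.ofReal (√(metric (c τ) (deriv c τ) (deriv c τ))) = ENNReal.ofReal ‖v‖ := by
      rw [setLIntegral_congr_fun (g := fun _ => ENNReal.ofReal (2 * ‖v‖)) measurableSet_Ioc]
      · rw [setLIntegral_const, Real.volume_Ioc, ← ENNReal.ofReal_mul (by positivity)]
        congr 1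
        ring
      · intro τ hτ
        simp only
        rw [(hhigh τ hτ.1).1, (hhigh τ hτ.1).2, sqrt_metric_smul]
        nth_rewrite 2 3 [hu' τ]
        rw [sqrt_metric_horizontal]
        norm_num
    rw [curveLength, hsplit, lintegral_union measurableSet_Ioc, hA, hB]
    · gcongr
    · exact Set.disjoint_left.2 fun x hx hy => absurd hx.2 (not_le.2 hy.1)

/-! ### Concatenated segments and staying inside the domain -/

/-- The endpoint of the concatenation of the horizontal segments with velocities in `l`,
starting from the origin. -/
def endpoint : List (Hor n) → Heis n
  | [] => 0
  | v :: l => mul (hexp v) (endpoint l)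

/-- The concatenation of the horizontal segments with velocities in `l`, starting from `p`,
is contained in `Ω`. -/
def PathIn (Ω : Set (Heis n)) : List (Hor n) → Heis n → Prop
  | [], p => p ∈ Ω
  | v :: l, p => (∀ τ ∈ Set.Icc (0 : ℝ) 1, mul p (hexp (τ • v)) ∈ Ω) ∧ PathIn Ω l (mul p (hexp v))

lemma PathIn.end_mem {Ω : Set (Heis n)} {l : List (Hor n)} {p : Heis n} (h : PathIn Ω l p) :
    mul p (endpoint l) ∈ Ω := by
  induction l generalizing p with
  | nil =>
    rw [endpoint, mul_zero']
    exact h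
  | cons v l ih =>
    rw [endpoint, ← mul_assoc']
    exact ih h.2

/-- Otherwise the interior of `Ω` and the complement of its closure would separate `S`. -/
lemma exists_mem_frontier_of_isPreconnected {X : Type*} [TopologicalSpace X] {S Ω : Set X}
    (hS : IsPreconnected S) (h1 : (S ∩ Ω).Nonempty) (h2 : (S ∩ Ωᶜ).Nonempty) :
    (S ∩ frontier Ω).Nonempty := by
  by_contra hcon
  rw [Set.not_nonempty_iff_eq_empty] at hcon
  have hnf : ∀ x ∈ S, x ∉ frontier Ω := fun x hx hf =>
    (Set.mem_empty_iff_false x).1 (hcon ▸ ⟨hx, hf⟩)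
  have hin : ∀ x ∈ S, x ∈ closure Ω → x ∈ interior Ω := fun x hx hc => by
    by_contra hi
    exact hnf x hx ⟨hc, hi⟩
  obtain ⟨x, hx, hxΩ⟩ := h1
  obtain ⟨y, hy, hyΩ⟩ := h2
  obtain ⟨z, _, hz1, hz2⟩ := hS (interior Ω) (closure Ω)ᶜ isOpen_interior
    isClosed_closure.isOpen_compl
    (fun z hz => (em (z ∈ closure Ω)).imp (hin z hz) id)
    ⟨x, hx, hin x hx (subset_closure hxΩ)⟩
    ⟨y, hy, fun hc => hyΩ (interior_subset (hin y hy hc))⟩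
  exact hz2 (subset_closure (interior_subset hz1))

/-- A concatenation of horizontal segments that is shorter than the distance to the boundary stays
in the domain. -/
lemma pathIn_of_length_lt {Ω : Set (Heis n)} {p : Heis n} {D : ℝ≥0∞}
    (hD : ∀ z ∈ frontier Ω, D ≤ ccDist p z) (l : List (Hor n)) (q : Heis n) (hq : q ∈ Ω)
    (L : ℝ≥0∞) (hL : Reaches p q L)
    (hlt : L + ENNReal.ofReal (l.map fun v => ‖v‖).sum < D) : PathIn Ω l q := by
  induction l generalizing q L with
  | nil => exact hq
  | cons v l ih =>
    have hnn : 0 ≤ (l.map fun v => ‖v‖).sum :=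
      List.sum_nonneg fun x hx => by
        obtain ⟨y, _, rfl⟩ := List.mem_map.1 hx
        exact norm_nonneg y
    rw [List.map_cons, List.sum_cons, ENNReal.ofReal_add (norm_nonneg v) hnn, ← add_assoc] at hlt
    have hseg : ∀ τ ∈ Set.Icc (0 : ℝ) 1, mul q (hexp (τ • v)) ∈ Ω := by
      -- A segment leaving `Ω` meets the frontier at some time `σ ≤ 1`. Stopping there gives a
      -- frontier point within `L + ‖v‖ < D` of `p`, a contradiction.
      by_contra! hcon
      obtain ⟨τ, hτ, hout⟩ := hcon
      have hpre : IsPreconnected ((fun τ : ℝ => mul q (hexp (τ • v))) '' Set.Icc 0 1) :=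
        isPreconnected_Icc.image _ (by fun_prop)
      obtain ⟨z, ⟨σ, hσ, rfl⟩, hz⟩ := exists_mem_frontier_of_isPreconnected hpre
        ⟨q, ⟨0, by simp, by simp⟩, hq⟩ ⟨_, ⟨τ, hτ, rfl⟩, hout⟩
      have h1 := (hD _ hz).trans (hL.mul_hexp (σ • v)).ccDist_le
      have h2 : ENNReal.ofReal ‖σ • v‖ ≤ ENNReal.ofReal ‖v‖ := by
        refine ENNReal.ofReal_le_ofReal ?_
        rw [norm_smul, Real.norm_of_nonneg hσ.1]
        exact mul_le_of_le_one_left (norm_nonneg v) hσ.2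
      refine absurd (h1.trans (add_le_add_right h2 L)) (not_le.2 (lt_of_le_of_lt ?_ hlt))
      exact le_self_add
    refine ⟨hseg, ih _ (by simpa using hseg 1 (by simp)) _ (hL.mul_hexp v) hlt⟩

/-! ### Weak derivatives along horizontal flows -/

/-- On `Ω`, the function `g` is the weak derivative of `F` along the horizontal left-invariant vector
field with coordinates `v`. -/
def IsWeakDirDeriv (Ω : Set (Heis n)) (v : Hor n) (F g : Heis n → ℝ) : Prop :=
  ∀ φ : Heis n → ℝ, ContDiff ℝ ((⊤ : ℕ∞) : WithTop ℕ∞) φ → HasCompactSupport φ → tsupport φ ⊆ Ω →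
    ∫ p, g p * φ p = -∫ p, F p * fderiv ℝ φ p (v, symp p.1 v)

instance isProbabilityMeasure_unitInterval :
    IsProbabilityMeasure (volume.restrict (Set.Icc (0 : ℝ) 1)) :=
  ⟨by simp⟩

/-- The vertical cross term is a multiple of `symp v v = 0`, so `τ ↦ exp(τv)` is a one-parameter
subgroup. -/
lemma mul_hexp_smul_mul (p : Heis n) (v : Hor n) (a b : ℝ) :
    mul (mul p (hexp (a • v))) (hexp (b • v)) = mul p (hexp ((a + b) • v)) := by
  rw [mul_hexp_smul (mul p _)]
  simp only [mul_hexp_smul, Prod.fst_add, Prod.smul_fst, symp_add_left, symp_smul_left, symp_self,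
    mul_zero, add_zero]
  rw [add_smul, add_assoc]

lemma mul_hexp_neg_smul_cancel (p : Heis n) (v : Hor n) (a : ℝ) :
    mul (mul p (hexp ((-a) • v))) (hexp (a • v)) = p := by
  rw [mul_hexp_smul_mul, neg_add_cancel, zero_smul, hexp_zero, mul_zero']

lemma mul_hexp_smul_neg_cancel (p : Heis n) (v : Hor n) (a : ℝ) :
    mul (mul p (hexp (a • v))) (hexp ((-a) • v)) = p := by
  rw [mul_hexp_smul_mul, add_neg_cancel, zero_smul, hexp_zero, mul_zero']

lemma mul_hexp_smul_fst_symp (p : Heis n) (v : Hor n) (a : ℝ) :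
    symp (mul p (hexp (a • v))).1 v = symp p.1 v := by
  simp [mul_hexp_smul, symp_add_left, symp_smul_left]

/-- A left-invariant horizontal vector field commutes with its own flow. -/
lemma fderiv_comp_mul_hexp {φ : Heis n → ℝ} (hφ : ContDiff ℝ 1 φ) (v : Hor n) (a : ℝ)
    (p : Heis n) :
    fderiv ℝ (fun p => φ (mul p (hexp (a • v)))) p (v, symp p.1 v) =
      fderiv ℝ φ (mul p (hexp (a • v))) (v, symp p.1 v) := by
  have hψ : Differentiable ℝ fun p => φ (mul p (hexp (a • v))) :=
    (hφ.comp (contDiff_mul_right _)).differentiable one_ne_zero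
  have hline : ∀ (x u : Heis n), HasDerivAt (fun σ : ℝ => x + σ • u) u 0 := fun x u => by
    simpa using ((hasDerivAt_id (0 : ℝ)).smul_const u).const_add x
  have h1 : HasDerivAt (fun σ : ℝ => φ (mul (p + σ • (v, symp p.1 v)) (hexp (a • v))))
      (fderiv ℝ (fun p => φ (mul p (hexp (a • v)))) p (v, symp p.1 v)) 0 := by
    refine HasFDerivAt.comp_hasDerivAt (0 : ℝ) (l := fun p => φ (mul p (hexp (a • v)))) ?_
      (hline p _)
    simpa using (hψ p).hasFDerivAt
  have h2 : HasDerivAt (fun σ : ℝ => φ (mul p (hexp (a • v)) + σ • (v, symp p.1 v)))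
      (fderiv ℝ φ (mul p (hexp (a • v))) (v, symp p.1 v)) 0 := by
    refine HasFDerivAt.comp_hasDerivAt (0 : ℝ) ?_ (hline _ _)
    simpa using (hφ.differentiable one_ne_zero _).hasFDerivAt
  refine h1.unique (h2.congr_of_eventuallyEq (Eventually.of_forall fun σ => ?_))
  have e : mul p (hexp (a • v)) + σ • (v, symp p.1 v) =
      mul (p + σ • (v, symp p.1 v)) (hexp (a • v)) := by
    rw [← mul_hexp_smul p σ v, mul_hexp_smul_mul, add_comm σ a, ← mul_hexp_smul_mul,
      mul_hexp_smul (mul p _), mul_hexp_smul_fst_symp]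
  simp only [e]

lemma hasDerivAt_comp_mul_hexp {φ : Heis n → ℝ} (hφ : ContDiff ℝ 1 φ) (v : Hor n)
    (p : Heis n) (τ : ℝ) :
    HasDerivAt (fun τ : ℝ => φ (mul p (hexp ((-τ) • v))))
      (-fderiv ℝ φ (mul p (hexp ((-τ) • v)))
        (v, symp (mul p (hexp ((-τ) • v))).1 v)) τ := by
  rw [mul_hexp_smul_fst_symp, ← map_neg]
  simp only [mul_hexp_smul]
  refine HasFDerivAt.comp_hasDerivAt τ (hφ.differentiable one_ne_zero _).hasFDerivAt ?_
  simpa using ((hasDerivAt_id τ).neg.smul_const ((v, symp p.1 v) : Heis n)).const_add p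

lemma continuous_dirDeriv {φ : Heis n → ℝ} (hφ : ContDiff ℝ 1 φ) (v : Hor n) :
    Continuous fun p => fderiv ℝ φ p (v, symp p.1 v) :=
  (hφ.continuous_fderiv one_ne_zero).clm_apply (by fun_prop)

lemma hasCompactSupport_dirDeriv {φ : Heis n → ℝ} (hφ : HasCompactSupport φ) (v : Hor n) :
    HasCompactSupport fun p => fderiv ℝ φ p (v, symp p.1 v) :=
  (hφ.fderiv ℝ).mono' fun p hp => subset_tsupport _ fun h => hp (by simp [h])

/-- Justifies Fubini. The integrand vanishes off the compact set `K` swept out by the support of `ψ`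
under the flow for times in `[0,1]`, so a multiple of the integrable function `1_K |g|` dominates
it. -/
lemma integrable_mul_comp_mul_hexp {g ψ : Heis n → ℝ} (hg : LocallyIntegrable g volume)
    (hgm : Measurable g) (hψ : Continuous ψ) (hψc : HasCompactSupport ψ) (v : Hor n) :
    Integrable (fun z : ℝ × Heis n => g z.2 * ψ (mul z.2 (hexp ((-z.1) • v))))
      ((volume.restrict (Set.Icc (0 : ℝ) 1)).prod volume) := by
  let K : Set (Heis n) :=
    (fun z : ℝ × Heis n => mul z.2 (hexp (z.1 • v))) '' (Set.Icc (0 : ℝ) 1 ×ˢ tsupport ψ)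
  have hK : IsCompact K := (isCompact_Icc.prod hψc).image (by fun_prop)
  obtain ⟨C, hC⟩ := hψ.bounded_above_of_compact_support hψc
  have hdom : Integrable (fun z : ℝ × Heis n => ‖K.indicator g z.2‖ * C)
      ((volume.restrict (Set.Icc (0 : ℝ) 1)).prod volume) :=
    ((((integrable_indicator_iff hK.measurableSet).2 (hg.integrableOn_isCompact hK)).norm).comp_snd
      _).mul_const C
  refine hdom.mono' (Measurable.aestronglyMeasurable ?_) ?_
  · exact (hgm.comp measurable_snd).mul
      (hψ.measurable.comp (Continuous.measurable (by fun_prop)))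
  · filter_upwards [Measure.quasiMeasurePreserving_fst.ae (ae_restrict_mem measurableSet_Icc)]
      with z hz
    rw [norm_mul]
    by_cases h0 : ψ (mul z.2 (hexp ((-z.1) • v))) = 0
    · rw [h0, norm_zero, mul_zero]
      exact mul_nonneg (norm_nonneg _) ((norm_nonneg _).trans (hC 0))
    · have hzK : z.2 ∈ K := by
        refine ⟨(z.1, mul z.2 (hexp ((-z.1) • v))), ⟨hz, subset_tsupport _ h0⟩, ?_⟩
        exact mul_hexp_neg_smul_cancel _ _ _
      rw [Set.indicator_of_mem hzK]
      exact mul_le_mul_of_nonneg_left (hC _) (norm_nonneg _)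

/-- Transfers integrability from `g(p) φ(p · exp(-τv))` to `g(p · exp(τv)) φ(p)`. -/
lemma measurePreserving_shear (v : Hor n) :
    MeasurePreserving (fun z : ℝ × Heis n => (z.1, mul z.2 (hexp (z.1 • v))))
      ((volume.restrict (Set.Icc (0 : ℝ) 1)).prod volume)
      ((volume.restrict (Set.Icc (0 : ℝ) 1)).prod volume) :=
  MeasurePreserving.skew_product (g := fun τ p => mul p (hexp (τ • v))) (MeasurePreserving.id _)
    (Continuous.measurable (by unfold Function.uncurry; fun_prop))
    (ae_of_all _ fun τ => (measurePreserving_mul_right _).map_eq)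

lemma measurable_comp_flow {g : Heis n → ℝ} (hgm : Measurable g) (v : Hor n) :
    Measurable fun z : Heis n × ℝ => g (mul z.1 (hexp (z.2 • v))) :=
  hgm.comp (Continuous.measurable (by fun_prop))

lemma eLpNorm_comp_mul_right_restrict_le {s : ℝ≥0∞} {E : Type*} [NormedAddCommGroup E]
    {g : Heis n → E} {S S' : Set (Heis n)} (hS' : MeasurableSet S')
    {q : Heis n} (hq : ∀ p ∈ S, mul p q ∈ S') :
    eLpNorm (fun p => g (mul p q)) s (volume.restrict S) ≤ eLpNorm g s (volume.restrict S') := by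
  have h : MeasurePreserving (fun p : Heis n => mul p q)
      (volume.restrict ((fun p => mul p q) ⁻¹' S')) (volume.restrict S') :=
    (measurePreserving_mul_right q).restrict_preimage hS'
  refine (eLpNorm_mono_measure _ (Measure.restrict_mono hq le_rfl)).trans
    (le_of_eq ?_)
  rw [← h.map_eq, (measurableEmbedding_mul_right q).eLpNorm_map_measure]
  rfl

lemma memLp_integral_flow {s : ℝ≥0∞} (hs : 1 ≤ s) (hs' : s ≠ ∞) {g : Heis n → ℝ}
    (hgm : Measurable g) (hg : MemLp g s volume) (v : Hor n) :
    MemLp (fun p => ∫ τ in Set.Icc (0 : ℝ) 1, g (mul p (hexp (τ • v)))) s volume := by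
  have hm := measurable_comp_flow hgm v
  have h := eLpNorm_integral_le (μ := volume) (ν := volume.restrict (Set.Icc (0 : ℝ) 1)) hs hs'
    (H := fun p τ => g (mul p (hexp (τ • v)))) hm
    (C := eLpNorm g s volume) (ae_of_all _ fun τ => by
      have := eLpNorm_comp_measurePreserving (p := s) hg.1
        (measurePreserving_mul_right (hexp (τ • v)))
      exact this.le)
  exact ⟨hm.stronglyMeasurable.integral_prod_right'.aestronglyMeasurable, h.trans_lt hg.2⟩

/-- Integration of a weak derivative along the flow of a horizontal left-invariant vector field. -/
lemma ae_sub_eq_integral_flow {s : ℝ≥0∞} (hs : 1 ≤ s) (hs' : s ≠ ∞) {Ω B : Set (Heis n)}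
    (hB : IsOpen B) {v : Hor n} {F g : Heis n → ℝ} (hFm : Measurable F) (hgm : Measurable g)
    (hF : MemLp F s volume) (hg : MemLp g s volume) (hw : IsWeakDirDeriv Ω v F g)
    (hBΩ : ∀ p ∈ B, ∀ τ ∈ Set.Icc (0 : ℝ) 1, mul p (hexp (τ • v)) ∈ Ω) :
    ∀ᵐ p, p ∈ B → F (mul p (hexp v)) - F p =
      ∫ τ in Set.Icc (0 : ℝ) 1, g (mul p (hexp (τ • v))) := by
  have hFl : LocallyIntegrable F volume := hF.locallyIntegrable hs
  have hgl : LocallyIntegrable g volume := hg.locallyIntegrable hs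
  let a : Heis n → ℝ := fun p => F (mul p (hexp v))
  let b : Heis n → ℝ := fun p => ∫ τ in Set.Icc (0 : ℝ) 1, g (mul p (hexp (τ • v)))
  have ha : LocallyIntegrable a volume :=
    (hF.comp_measurePreserving (measurePreserving_mul_right _)).locallyIntegrable hs
  have hb : LocallyIntegrable b volume :=
    (memLp_integral_flow hs hs' hgm hg v).locallyIntegrable hs
  -- It is enough to test the identity against smooth `φ` with compact support in `B`.
  have key : ∀ᵐ p, p ∈ B → (a p - F p) - b p = 0 := by
    refine hB.ae_eq_zero_of_integral_contDiff_smul_eq_zero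
      (((ha.sub hFl).sub hb).locallyIntegrableOn _) fun φ hφ hφc hφB => ?_
    have hφ1 : ContDiff ℝ 1 φ := hφ.of_le (by exact_mod_cast le_top)
    have hia := ha.integrable_smul_left_of_hasCompactSupport hφ.continuous hφc
    have hiF := hFl.integrable_smul_left_of_hasCompactSupport hφ.continuous hφc
    have hib := hb.integrable_smul_left_of_hasCompactSupport hφ.continuous hφc
    simp only [smul_eq_mul] at hia hiF hib ⊢
    let D : Heis n → ℝ := fun p => fderiv ℝ φ p (v, symp p.1 v)
    have hD : Continuous D := continuous_dirDeriv hφ1 v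
    have hDc : HasCompactSupport D := hasCompactSupport_dirDeriv hφc v
    have h1 : ∫ p, φ p * a p = ∫ p, F p * φ (mul p (hexp ((-1 : ℝ) • v))) := by
      rw [← (measurePreserving_mul_right (hexp v)).integral_comp
        (measurableEmbedding_mul_right _) (fun p => F p * φ (mul p (hexp ((-1 : ℝ) • v))))]
      refine integral_congr_ae (ae_of_all _ fun p => ?_)
      simp only [a]
      rw [neg_one_smul, hexp_neg, mul_neg_cancel_right', mul_comm]
    have hi1 : Integrable fun p => F p * φ (mul p (hexp ((-1 : ℝ) • v))) :=
      hFl.integrable_smul_right_of_hasCompactSupport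
        (hφ.continuous.comp (by fun_prop : Continuous fun p => mul p (hexp ((-1 : ℝ) • v))))
        (hφc.comp_homeomorph (rightMul _))
    -- The translation has been moved onto the smooth test function, where the classical fundamental
    -- theorem applies along the backward flow.
    have hftc : ∀ p, φ (mul p (hexp ((-1 : ℝ) • v))) - φ p =
        ∫ τ in Set.Icc (0 : ℝ) 1, -D (mul p (hexp ((-τ) • v))) := fun p => by
      have := intervalIntegral.integral_eq_sub_of_hasDerivAt (a := (0 : ℝ)) (b := 1)
        (fun τ _ => hasDerivAt_comp_mul_hexp hφ1 v p τ)
        (Continuous.intervalIntegrable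
          (hD.comp (by fun_prop : Continuous fun τ : ℝ => mul p (hexp ((-τ) • v)))).neg _ _)
      rw [intervalIntegral.integral_of_le zero_le_one, ← integral_Icc_eq_integral_Ioc] at this
      simpa using this.symm
    -- For fixed `τ`, the transported function `φ(p · exp(-τv))` is an admissible test function: its
    -- support is the flow image of that of `φ`, which `hBΩ` places in `Ω`. The field commutes with
    -- its flow, so the derivative falls on `φ` itself.
    have hweak : ∀ τ ∈ Set.Icc (0 : ℝ) 1, ∫ p, -(F p * D (mul p (hexp ((-τ) • v)))) =
        ∫ p, g (mul p (hexp (τ • v))) * φ p := fun τ hτ => by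
      have hsupp : tsupport (fun p => φ (mul p (hexp ((-τ) • v)))) ⊆ Ω := by
        intro p hp
        have hp' : mul p (hexp ((-τ) • v)) ∈ tsupport φ := by
          have := tsupport_comp_subset_preimage φ (rightMul (hexp ((-τ) • v))).continuous
          exact this hp
        have h := hBΩ _ (hφB hp') τ hτ
        rwa [mul_hexp_neg_smul_cancel] at h
      have := hw (fun p => φ (mul p (hexp ((-τ) • v)))) (hφ.comp (contDiff_mul_right _))
        (hφc.comp_homeomorph (rightMul _)) hsupp
      rw [integral_neg]
      simp only [fderiv_comp_mul_hexp hφ1] at this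
      simp only [D, mul_hexp_smul_fst_symp]
      rw [← this, ← (measurePreserving_mul_right (hexp (τ • v))).integral_comp
        (measurableEmbedding_mul_right _)]
      simp only [mul_hexp_smul_neg_cancel]
    have hint1 := (integrable_mul_comp_mul_hexp hFl hFm hD hDc v).neg
    have hint2 : Integrable (fun z : ℝ × Heis n => g (mul z.2 (hexp (z.1 • v))) * φ z.2)
        ((volume.restrict (Set.Icc (0 : ℝ) 1)).prod volume) := by
      have := (measurePreserving_shear v).integrable_comp_of_integrable
        (integrable_mul_comp_mul_hexp hgl hgm hφ.continuous hφc v)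
      simpa only [Function.comp_def, mul_hexp_smul_neg_cancel] using this
    have hmain : ∫ p, (φ p * a p - φ p * F p) = ∫ p, φ p * b p := by
      calc ∫ p, (φ p * a p - φ p * F p)
          = ∫ p, (F p * φ (mul p (hexp ((-1 : ℝ) • v))) - φ p * F p) := by
            rw [integral_sub hia hiF, h1, integral_sub hi1 hiF]
        _ = ∫ p, ∫ τ in Set.Icc (0 : ℝ) 1, -(F p * D (mul p (hexp ((-τ) • v)))) := by
            refine integral_congr_ae (ae_of_all _ fun p => ?_)
            simp only
            rw [mul_comm (φ p), ← mul_sub, hftc, ← integral_const_mul]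
            simp only [mul_neg]
        _ = ∫ τ in Set.Icc (0 : ℝ) 1, ∫ p, -(F p * D (mul p (hexp ((-τ) • v)))) :=
            (integral_integral_swap hint1).symm
        _ = ∫ τ in Set.Icc (0 : ℝ) 1, ∫ p, g (mul p (hexp (τ • v))) * φ p :=
            setIntegral_congr_fun measurableSet_Icc hweak
        _ = ∫ p, ∫ τ in Set.Icc (0 : ℝ) 1, g (mul p (hexp (τ • v))) * φ p :=
            integral_integral_swap hint2
        _ = ∫ p, φ p * b p := by
            refine integral_congr_ae (ae_of_all _ fun p => ?_)
            simp only [b]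
            rw [integral_mul_const, mul_comm]
    simp only [mul_sub]
    rw [integral_sub (f := fun p => φ p * a p - φ p * F p) (hia.sub hiF) hib, hmain, sub_self]
  filter_upwards [key] with p hp hpB
  exact sub_eq_zero.1 (hp hpB)

lemma isOpen_image_mul_right {A : Set (Heis n)} (hA : IsOpen A) (q : Heis n) :
    IsOpen ((fun p => mul p q) '' A) :=
  (rightMul q).isOpenMap A hA

lemma eLpNorm_inner_le {s : ℝ≥0∞} {μ : Measure (Heis n)} (G : Heis n → Hor n) (v : Hor n) :
    eLpNorm (fun p => inner ℝ (G p) v) s μ ≤ ENNReal.ofReal ‖v‖ * eLpNorm G s μ :=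
  eLpNorm_le_mul_eLpNorm_of_ae_le_mul
    (ae_of_all _ fun _ => (norm_inner_le_norm _ _).trans_eq (mul_comm _ _)) s

lemma memLp_inner {s : ℝ≥0∞} {μ : Measure (Heis n)} {G : Heis n → Hor n} (hG : MemLp G s μ)
    (v : Hor n) : MemLp (fun p => inner ℝ (G p) v) s μ :=
  ⟨hG.1.inner aestronglyMeasurable_const,
    (eLpNorm_inner_le G v).trans_lt (ENNReal.mul_lt_top ENNReal.ofReal_lt_top hG.2)⟩

/-! ### Increments and difference quotients along concatenated segments -/

section Paths

variable {s : ℝ≥0∞} {Ω : Set (Heis n)} {F : Heis n → ℝ} {G : Heis n → Hor n}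

/-- The increment along a concatenation of horizontal segments is bounded by its length times the
norm of the horizontal gradient. -/
lemma eLpNorm_sub_le_of_pathIn (hs : 1 ≤ s) (hs' : s ≠ ∞) (hΩ : IsOpen Ω) (hFm : Measurable F)
    (hGm : Measurable G) (hF : MemLp F s volume) (hG : MemLp G s volume)
    (hw : ∀ v, IsWeakDirDeriv Ω v F fun p => inner ℝ (G p) v) (l : List (Hor n))
    (A : Set (Heis n)) (hA : IsOpen A) (hpath : ∀ p ∈ A, PathIn Ω l p) :
    eLpNorm (fun p => F (mul p (endpoint l)) - F p) s (volume.restrict A) ≤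
      ENNReal.ofReal (l.map fun v => ‖v‖).sum * eLpNorm G s (volume.restrict Ω) := by
  induction l generalizing A with
  | nil => simp [endpoint]
  | cons v l ih =>
    have hnn : 0 ≤ (l.map fun v => ‖v‖).sum :=
      List.sum_nonneg fun x hx => by
        obtain ⟨y, _, rfl⟩ := List.mem_map.1 hx
        exact norm_nonneg y
    have hgm : Measurable fun p => (inner ℝ (G p) v : ℝ) := hGm.inner measurable_const
    have hm : ∀ q : Heis n, Measurable fun p => F (mul p q) := fun q =>
      hFm.comp (measurePreserving_mul_right q).measurable
    have h1 : eLpNorm (fun p => F (mul (mul p (hexp v)) (endpoint l)) - F (mul p (hexp v))) s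
        (volume.restrict A) ≤
        ENNReal.ofReal (l.map fun v => ‖v‖).sum * eLpNorm G s (volume.restrict Ω) := by
      -- After the first segment, the remaining path starts from the translated set `A · exp(v)`;
      -- the induction runs over all open sets for this reason.
      have hA' := isOpen_image_mul_right hA (hexp v)
      refine (eLpNorm_comp_mul_right_restrict_le (g := fun q => F (mul q (endpoint l)) - F q)
        hA'.measurableSet (fun p hp => Set.mem_image_of_mem _ hp)).trans (ih _ hA' ?_)
      rintro _ ⟨p, hp, rfl⟩
      exact (hpath p hp).2
    have h2 : eLpNorm (fun p => F (mul p (hexp v)) - F p) s (volume.restrict A) ≤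
        ENNReal.ofReal ‖v‖ * eLpNorm G s (volume.restrict Ω) := by
      have hae := ae_sub_eq_integral_flow hs hs' hA hFm hgm hF (memLp_inner hG v) (hw v)
        fun p hp => (hpath p hp).1
      rw [eLpNorm_congr_ae ((ae_restrict_iff' hA.measurableSet).2 hae)]
      refine eLpNorm_integral_le hs hs' (H := fun p τ => (inner ℝ (G (mul p (hexp (τ • v)))) v : ℝ))
        (measurable_comp_flow hgm v) ?_
      filter_upwards [ae_restrict_mem measurableSet_Icc] with τ hτ
      exact (eLpNorm_comp_mul_right_restrict_le (g := fun q => (inner ℝ (G q) v : ℝ))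
        hΩ.measurableSet fun p hp => (hpath p hp).1 τ hτ).trans (eLpNorm_inner_le G v)
    have hsplit : (fun p => F (mul p (endpoint (v :: l))) - F p) =
        (fun p => F (mul (mul p (hexp v)) (endpoint l)) - F (mul p (hexp v))) +
          fun p => F (mul p (hexp v)) - F p := by
      funext p
      simp [endpoint, mul_assoc']
    rw [hsplit, List.map_cons, List.sum_cons, ENNReal.ofReal_add (norm_nonneg v) hnn, add_mul,
      add_comm (_ * _)]
    refine (eLpNorm_add_le ?_ ?_ hs).trans (add_le_add h1 h2)
    · simp only [mul_assoc']
      exact ((hm _).sub (hm _)).aestronglyMeasurable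
    · exact ((hm _).sub hFm).aestronglyMeasurable

lemma tendsto_hexp_smul (v : Hor n) : Tendsto (fun ε : ℝ => hexp (ε • v)) (𝓝[>] 0) (𝓝 0) := by
  have : Continuous fun ε : ℝ => hexp (ε • v) := by fun_prop
  simpa using (this.tendsto 0).mono_left nhdsWithin_le_nhds

/-- Uniformity in `τ` holds because `exp(τεv)` has norm at most that of `exp(εv)`, so one ball
around the origin contains the whole segment. -/
lemma tendsto_iSup_eLpNorm_flow_sub (hs : 1 ≤ s) (hs' : s ≠ ∞) {g : Heis n → ℝ}
    (hg : MemLp g s volume) (v : Hor n) :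
    Tendsto (fun ε : ℝ => ⨆ τ ∈ Set.Icc (0 : ℝ) 1,
      eLpNorm (fun p => g (mul p (hexp (τ • ε • v))) - g p) s volume) (𝓝[>] 0) (𝓝 0) := by
  have h := tendsto_eLpNorm_mul_right_sub hs hs' hg
  rw [ENNReal.tendsto_nhds_zero] at h ⊢
  intro η hη
  obtain ⟨r, hr, hball⟩ := Metric.eventually_nhds_iff_ball.1 (h η hη)
  have hev := (tendsto_hexp_smul v).eventually (Metric.ball_mem_nhds 0 hr)
  filter_upwards [hev] with ε hε
  refine iSup₂_le fun τ hτ => hball _ ?_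
  rw [mem_ball_zero_iff]
  rw [dist_zero_right] at hε
  refine lt_of_le_of_lt ?_ hε
  have : hexp (τ • ε • v) = τ • hexp (ε • v) := by simp [hexp]
  rw [this, norm_smul, Real.norm_of_nonneg hτ.1]
  exact mul_le_of_le_one_left (norm_nonneg _) hτ.2

/-- The error is the average over `τ` of `g(p · exp(τεv)) - g(p)`, where `g = ⟨G, v⟩`. The bound is
taken over the whole space so that it does not depend on `A`. -/
lemma eLpNorm_segment_quotient_sub_le (hs : 1 ≤ s) (hs' : s ≠ ∞) (hFm : Measurable F)
    (hGm : Measurable G) (hF : MemLp F s volume) (hG : MemLp G s volume)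
    (hw : ∀ v, IsWeakDirDeriv Ω v F fun p => inner ℝ (G p) v) (v : Hor n) {ε : ℝ} (hε : 0 < ε)
    {A : Set (Heis n)} (hA : IsOpen A)
    (hpath : ∀ p ∈ A, ∀ τ ∈ Set.Icc (0 : ℝ) 1, mul p (hexp (τ • ε • v)) ∈ Ω) :
    eLpNorm (fun p => ε⁻¹ * (F (mul p (hexp (ε • v))) - F p) - inner ℝ (G p) v) s
      (volume.restrict A) ≤
    ⨆ τ ∈ Set.Icc (0 : ℝ) 1, eLpNorm
      (fun p => (inner ℝ (G (mul p (hexp (τ • ε • v)))) v : ℝ) - inner ℝ (G p) v) s volume := by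
  let g : Heis n → ℝ := fun p => inner ℝ (G p) v
  have hgm : Measurable g := hGm.inner measurable_const
  have hg : MemLp g s volume := memLp_inner hG v
  have hae := ae_sub_eq_integral_flow hs hs' hA hFm (hGm.inner measurable_const) hF
    (memLp_inner hG (ε • v)) (hw (ε • v)) hpath
  have hintegr : ∀ᵐ p, Integrable (fun τ : ℝ => g (mul p (hexp (τ • ε • v))))
      (volume.restrict (Set.Icc (0 : ℝ) 1)) :=
    ae_integrable_of_eLpNorm_le hs hs' (H := fun p τ => g (mul p (hexp (τ • ε • v))))
      (measurable_comp_flow hgm (ε • v)) hg.2.ne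
      (ae_of_all _ fun τ => by
        have := eLpNorm_comp_measurePreserving (p := s) hg.1
          (measurePreserving_mul_right (hexp (τ • ε • v)))
        exact this.le)
  have heq : (fun p => ε⁻¹ * (F (mul p (hexp (ε • v))) - F p) - inner ℝ (G p) v)
      =ᵐ[volume.restrict A]
      fun p => ∫ τ in Set.Icc (0 : ℝ) 1, (g (mul p (hexp (τ • ε • v))) - g p) := by
    rw [EventuallyEq, ae_restrict_iff' hA.measurableSet]
    filter_upwards [hae, hintegr] with p hp hi hpA
    rw [hp hpA, integral_sub hi (integrable_const _)]
    simp only [inner_smul_right, integral_const_mul, g]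
    rw [inv_mul_cancel_left₀ hε.ne']
    simp
  rw [eLpNorm_congr_ae heq]
  refine eLpNorm_integral_le hs hs'
    (H := fun p τ => g (mul p (hexp (τ • ε • v))) - g p)
    ((measurable_comp_flow hgm (ε • v)).sub (hgm.comp measurable_fst)) ?_
  filter_upwards [ae_restrict_mem measurableSet_Icc] with τ hτ
  exact (eLpNorm_mono_measure _ Measure.restrict_le_self).trans
    (le_iSup₂ (f := fun (τ : ℝ) (_ : τ ∈ Set.Icc (0 : ℝ) 1) =>
      eLpNorm (fun p => g (mul p (hexp (τ • ε • v))) - g p) s volume) τ hτ)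

/-- The difference quotient along rescaled concatenations of horizontal segments converges to the
horizontal derivative along the total horizontal displacement, uniformly in the set `A`. -/
lemma exists_modulus_of_pathIn (hs : 1 ≤ s) (hs' : s ≠ ∞) (hFm : Measurable F)
    (hGm : Measurable G) (hF : MemLp F s volume) (hG : MemLp G s volume)
    (hw : ∀ v, IsWeakDirDeriv Ω v F fun p => inner ℝ (G p) v) (l : List (Hor n)) :
    ∃ ω : ℝ → ℝ≥0∞, Tendsto ω (𝓝[>] 0) (𝓝 0) ∧ ∀ ε > 0, ∀ A : Set (Heis n), IsOpen A →
      (∀ p ∈ A, PathIn Ω (l.map fun v => ε • v) p) →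
      eLpNorm (fun p => ε⁻¹ * (F (mul p (endpoint (l.map fun v => ε • v))) - F p) -
        inner ℝ (G p) l.sum) s (volume.restrict A) ≤ ω ε := by
  induction l with
  | nil => exact ⟨fun _ => 0, tendsto_const_nhds, fun ε _ A _ _ => by simp [endpoint]⟩
  | cons v l ih =>
    obtain ⟨ω, hω, hωle⟩ := ih
    let g : Heis n → ℝ := fun p => inner ℝ (G p) l.sum
    have hgm : Measurable g := hGm.inner measurable_const
    have hg : MemLp g s volume := memLp_inner hG _
    have hm : ∀ q : Heis n, Measurable fun p => F (mul p q) := fun q =>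
      hFm.comp (measurePreserving_mul_right q).measurable
    have hmg : ∀ q : Heis n, Measurable fun p => g (mul p q) := fun q =>
      hgm.comp (measurePreserving_mul_right q).measurable
    -- The three terms bound the error on the remaining path, the change of its limiting derivative
    -- when the base point moves by `exp(εv)`, and the error on the first segment. Since `ω` is
    -- independent of the set, the induction hypothesis applies to `A · exp(εv)`, which varies with
    -- `ε`.
    refine ⟨fun ε => ω ε + eLpNorm (fun p => g (mul p (hexp (ε • v))) - g p) s volume +
      ⨆ τ ∈ Set.Icc (0 : ℝ) 1, eLpNorm
        (fun p => (inner ℝ (G (mul p (hexp (τ • ε • v)))) v : ℝ) - inner ℝ (G p) v) s volume,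
      ?_, fun ε hε A hA hpath => ?_⟩
    · simpa using (hω.add ((tendsto_eLpNorm_mul_right_sub hs hs' hg).comp
        (tendsto_hexp_smul v))).add (tendsto_iSup_eLpNorm_flow_sub hs hs' (memLp_inner hG v) v)
    · let E := endpoint (l.map fun v => ε • v)
      let u₁ : Heis n → ℝ := fun p => ε⁻¹ * (F (mul (mul p (hexp (ε • v))) E) -
        F (mul p (hexp (ε • v)))) - g (mul p (hexp (ε • v)))
      let u₂ : Heis n → ℝ := fun p => g (mul p (hexp (ε • v))) - g p
      let u₃ : Heis n → ℝ := fun p => ε⁻¹ * (F (mul p (hexp (ε • v))) - F p) - inner ℝ (G p) v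
      have hsplit : (fun p => ε⁻¹ * (F (mul p (endpoint ((v :: l).map fun v => ε • v))) - F p) -
          inner ℝ (G p) (v :: l).sum) = u₁ + u₂ + u₃ := by
        funext p
        simp only [u₁, u₂, u₃, g, E, Pi.add_apply, List.map_cons, endpoint, mul_assoc',
          List.sum_cons, inner_add_right]
        ring
      have h₁ : eLpNorm u₁ s (volume.restrict A) ≤ ω ε := by
        have hA' := isOpen_image_mul_right hA (hexp (ε • v))
        refine (eLpNorm_comp_mul_right_restrict_le
          (g := fun q => ε⁻¹ * (F (mul q E) - F q) - g q) hA'.measurableSet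
          (fun p hp => Set.mem_image_of_mem _ hp)).trans (hωle ε hε _ hA' ?_)
        rintro _ ⟨p, hp, rfl⟩
        exact (hpath p hp).2
      have h₂ : eLpNorm u₂ s (volume.restrict A) ≤ eLpNorm u₂ s volume :=
        eLpNorm_mono_measure _ Measure.restrict_le_self
      have h₃ := eLpNorm_segment_quotient_sub_le hs hs' hFm hGm hF hG hw v hε hA
        fun p hp => (hpath p hp).1
      have m₁ : Measurable u₁ := by
        simp only [u₁, mul_assoc']
        exact (((hm _).sub (hm _)).const_mul _).sub (hmg _)
      have m₂ : Measurable u₂ := (hmg _).sub hgm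
      have m₃ : Measurable u₃ := (((hm _).sub hFm).const_mul _).sub (hGm.inner measurable_const)
      rw [hsplit]
      exact (eLpNorm_add_le (m₁.add m₂).aestronglyMeasurable m₃.aestronglyMeasurable hs).trans
        (add_le_add ((eLpNorm_add_le m₁.aestronglyMeasurable m₂.aestronglyMeasurable hs).trans
          (add_le_add h₁ h₂)) h₃)

end Paths

/-! ### Dilations and a horizontal path to an arbitrary point -/

lemma dil_mul (r : ℝ) (p q : Heis n) : dil r (mul p q) = mul (dil r p) (dil r q) := by
  simp only [dil, mul_def, symp_smul_left, symp_smul_right, smul_add]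
  ext1
  · rfl
  · simp only
    ring

lemma endpoint_map_smul (r : ℝ) (l : List (Hor n)) :
    endpoint (l.map fun v => r • v) = dil r (endpoint l) := by
  induction l with
  | nil => simp [endpoint, dil, Prod.ext_iff]
  | cons v l ih =>
    rw [List.map_cons, endpoint, endpoint, ih, dil_mul]
    simp [hexp, dil]

lemma symp_single (i : Fin n) (a b : ℝ) :
    symp (EuclideanSpace.single (Sum.inl i) a : Hor n) (EuclideanSpace.single (Sum.inr i) b) =
      -(2 * (a * b)) := by
  simp [symp]

/-- Every point is the endpoint of a horizontal segment followed by a square, of total length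
`|w_H| + 2 √|w_N|`. -/
lemma exists_endpoint_eq (hn : 1 ≤ n) (w : Heis n) :
    ∃ l : List (Hor n), endpoint l = w ∧ l.sum = w.1 ∧
      (l.map fun v => ‖v‖).sum = ‖w.1‖ + 2 * √|w.2| := by
  let i : Fin n := ⟨0, hn⟩
  -- The square with sides `a, b, -a, -b` raises the vertical coordinate by `2 symp a b = -4cd`.
  -- Choosing `|c| = |d| = √|w_N| / 2` gives it perimeter `2√|w_N|`, and the sign of `d` matches
  -- that of `w_N`. The initial segment `w_H` adds no cross term because the sides sum to zero.
  obtain ⟨c, d, hcd, hc, hd⟩ : ∃ c d : ℝ, -(4 * (c * d)) = w.2 ∧ |c| = √|w.2| / 2 ∧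
      |d| = √|w.2| / 2 := by
    have hsq := Real.mul_self_sqrt (abs_nonneg w.2)
    have h0 := Real.sqrt_nonneg |w.2|
    rcases le_total 0 w.2 with h | h
    · refine ⟨√|w.2| / 2, -(√|w.2| / 2), ?_, ?_, ?_⟩
      · rw [abs_of_nonneg h] at hsq ⊢
        linarith
      · rw [abs_of_nonneg (by positivity)]
      · rw [abs_neg, abs_of_nonneg (by positivity)]
    · refine ⟨√|w.2| / 2, √|w.2| / 2, ?_, ?_, ?_⟩
      · rw [abs_of_nonpos h] at hsq ⊢
        linarith
      · rw [abs_of_nonneg (by positivity)]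
      · rw [abs_of_nonneg (by positivity)]
  let a : Hor n := EuclideanSpace.single (Sum.inl i) c
  let b : Hor n := EuclideanSpace.single (Sum.inr i) d
  have hab : symp a b = -(2 * (c * d)) := symp_single i c d
  have hba : symp b a = 2 * (c * d) := by rw [symp_neg_swap, hab, neg_neg]
  refine ⟨[w.1, a, b, -a, -b], ?_, ?_, ?_⟩
  · simp only [endpoint, hexp, mul_def, Prod.fst_zero, Prod.snd_zero]
    ext1
    · simp
    · simp [symp_add_right, symp_neg_right, symp_neg_left, hab, hba]
      linarith
  · simp
  · have ha' : ‖a‖ = √|w.2| / 2 := by simp [a, hc]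
    have hb' : ‖b‖ = √|w.2| / 2 := by simp [b, hd]
    simp [ha', hb']
    ring

/-! ### From the weak horizontal gradient to directional derivatives -/

lemma integrable_mul_of_locallyIntegrableOn {Ω : Set (Heis n)} {g φ : Heis n → ℝ}
    (hg : LocallyIntegrableOn g Ω volume) (hφ : Continuous φ) (hφc : HasCompactSupport φ)
    (hφΩ : tsupport φ ⊆ Ω) : Integrable fun p => g p * φ p := by
  rw [← integrableOn_iff_integrable_of_support_subset (s := tsupport φ)]
  · exact (hg.integrableOn_compact_subset hφΩ hφc).mul_continuousOn hφ.continuousOn hφc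
  · exact fun p hp => subset_tsupport _ (right_ne_zero_of_mul hp)

lemma setIntegral_mul_eq_integral {Ω : Set (Heis n)} {φ : Heis n → ℝ} (hφΩ : tsupport φ ⊆ Ω)
    (g : Heis n → ℝ) : ∫ p in Ω, g p * φ p = ∫ p, g p * φ p :=
  setIntegral_eq_integral_of_forall_compl_eq_zero fun p hp => by
    rw [image_eq_zero_of_notMem_tsupport fun h => hp (hφΩ h), mul_zero]

/-- Weak horizontal derivatives are unique. -/
lemma IsWeakZDeriv.ae_eq {Ω : Set (Heis n)} (hΩ : IsOpen Ω) {j : Fin n ⊕ Fin n}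
    {u g g' : Heis n → ℝ} (h : IsWeakZDeriv Ω j u g) (h' : IsWeakZDeriv Ω j u g') :
    g =ᵐ[volume.restrict Ω] g' := by
  rw [EventuallyEq, ae_restrict_iff' hΩ.measurableSet]
  have := hΩ.ae_eq_zero_of_integral_contDiff_smul_eq_zero (h.2.1.sub h'.2.1)
    fun φ hφ hφc hφΩ => by
      have hi := integrable_mul_of_locallyIntegrableOn h.2.1 hφ.continuous hφc hφΩ
      have hi' := integrable_mul_of_locallyIntegrableOn h'.2.1 hφ.continuous hφc hφΩ
      have e := (h.2.2 φ hφ hφc hφΩ).trans (h'.2.2 φ hφ hφc hφΩ).symm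
      rw [setIntegral_mul_eq_integral hφΩ, setIntegral_mul_eq_integral hφΩ] at e
      simp only [Pi.sub_apply, smul_eq_mul, mul_comm (φ _), sub_mul]
      rw [integral_sub hi hi', e, sub_self]
  filter_upwards [this] with p hp hpΩ
  exact sub_eq_zero.1 (hp hpΩ)

/-- Sobolev membership supplies some weak derivatives in `L^s`; uniqueness identifies them with the
components of `gradf`. -/
lemma memLp_of_isWeakHorizontalGradient {s : ℝ≥0∞} {Ω : Set (Heis n)} (hΩ : IsOpen Ω)
    {f : Heis n → ℝ} (hf : MemHorizontalSobolev s Ω f) {gradf : Heis n → Hor n}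
    (hgradf : IsWeakHorizontalGradient Ω f gradf) : MemLp gradf s (volume.restrict Ω) := by
  refine MemLp.of_eval_piLp fun j => ?_
  obtain ⟨g, hg, hgw⟩ := hf.2 j
  exact hg.ae_eq (hgw.ae_eq hΩ (hgradf j))

/-- The field with coordinates `v` is `∑ v_j Z_j`, so the identity is linear in the coordinate ones.
The values of `F` and `G` off `Ω` are irrelevant, as the test functions are supported in `Ω`. -/
lemma isWeakDirDeriv_of_isWeakHorizontalGradient {s : ℝ≥0∞} (hs : 1 ≤ s) {Ω : Set (Heis n)}
    {f F : Heis n → ℝ} {gradf G : Heis n → Hor n}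
    (hgradf : IsWeakHorizontalGradient Ω f gradf) (hF : MemLp F s volume) (hG : MemLp G s volume)
    (hFf : F =ᵐ[volume.restrict Ω] f) (hGg : G =ᵐ[volume.restrict Ω] gradf) (v : Hor n) :
    IsWeakDirDeriv Ω v F fun p => inner ℝ (G p) v := by
  intro φ hφ hφc hφΩ
  have hφ1 : ContDiff ℝ 1 φ := hφ.of_le (by exact_mod_cast le_top)
  have hZ : ∀ j, (ZDeriv j φ : Heis n → ℝ) =
      fun p => fderiv ℝ φ p (EuclideanSpace.single j 1, symp p.1 (EuclideanSpace.single j 1)) := by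
    intro j
    funext p
    simp [ZDeriv, Z, ← sum_mul_vertCoeff, -Fintype.sum_sum_type]
  have hZs : ∀ j, tsupport (ZDeriv j φ : Heis n → ℝ) ⊆ Ω := fun j => by
    refine subset_trans (closure_minimal (fun p hp => ?_) (isClosed_tsupport φ)) hφΩ
    refine support_fderiv_subset ℝ fun h0 => hp ?_
    simp [ZDeriv, h0]
  have hiG : ∀ j, Integrable fun p => v j * (G p j * φ p) := fun j =>
    Integrable.const_mul ((hG.eval_piLp j).locallyIntegrable hs
      |>.integrable_smul_right_of_hasCompactSupport hφ.continuous hφc) _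
  have hiF : ∀ j, Integrable fun p => v j * (F p * ZDeriv j φ p) := fun j => by
    rw [hZ]
    exact Integrable.const_mul (hF.locallyIntegrable hs
      |>.integrable_smul_right_of_hasCompactSupport (continuous_dirDeriv hφ1 _)
      (hasCompactSupport_dirDeriv hφc _)) _
  have hj : ∀ j, ∫ p, G p j * φ p = -∫ p, F p * ZDeriv j φ p := fun j => by
    rw [← setIntegral_mul_eq_integral hφΩ (fun p => G p j), ← setIntegral_mul_eq_integral (hZs j)]
    have e1 : ∫ p in Ω, G p j * φ p = ∫ p in Ω, gradf p j * φ p :=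
      integral_congr_ae (by filter_upwards [hGg] with p hp; rw [hp])
    have e2 : ∫ p in Ω, F p * ZDeriv j φ p = ∫ p in Ω, f p * ZDeriv j φ p :=
      integral_congr_ae (by filter_upwards [hFf] with p hp; rw [hp])
    rw [e1, e2]
    exact (hgradf j).2.2 φ hφ hφc hφΩ
  calc ∫ p, (inner ℝ (G p) v : ℝ) * φ p = ∫ p, ∑ j, v j * (G p j * φ p) := by
        refine integral_congr_ae (ae_of_all _ fun p => ?_)
        simp only [PiLp.inner_apply, Finset.sum_mul]
        refine Finset.sum_congr rfl fun j _ => ?_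
        simp [mul_assoc]
    _ = ∑ j, v j * ∫ p, G p j * φ p := by
        rw [integral_finsetSum _ fun j _ => hiG j]
        simp only [integral_const_mul]
    _ = -∑ j, v j * ∫ p, F p * ZDeriv j φ p := by
        simp only [hj, mul_neg, Finset.sum_neg_distrib]
    _ = -∫ p, ∑ j, v j * (F p * ZDeriv j φ p) := by
        rw [integral_finsetSum _ fun j _ => hiF j]
        simp only [integral_const_mul]
    _ = -∫ p, F p * fderiv ℝ φ p (v, symp p.1 v) := by
        congr 1
        refine integral_congr_ae (ae_of_all _ fun p => ?_)
        simp only [← sum_smul_Z, map_sum, map_smul, smul_eq_mul, Finset.mul_sum, ZDeriv]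
        exact Finset.sum_congr rfl fun j _ => by ring

lemma pathIn_of_lt_ccSetDist {Ω A : Set (Heis n)} (hAΩ : A ⊆ Ω) {l : List (Hor n)}
    (h : ENNReal.ofReal (l.map fun v => ‖v‖).sum < ccSetDist A (frontier Ω)) :
    ∀ p ∈ A, PathIn Ω l p := fun p hp =>
  pathIn_of_length_lt (D := ccSetDist A (frontier Ω))
    (fun z hz => (iInf₂_le p hp).trans (iInf₂_le z hz)) l p (hAΩ hp) 0 (reaches_refl p)
    (by rwa [zero_add])

lemma sum_norm_map_smul {ε : ℝ} (hε : 0 < ε) (l : List (Hor n)) :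
    ((l.map fun v => ε • v).map fun v => ‖v‖).sum = ε * (l.map fun v => ‖v‖).sum := by
  simp only [List.map_map, ← List.sum_map_mul_left, Function.comp_def, norm_smul,
    Real.norm_of_nonneg hε.le]

/-- The translated point avoids the exceptional null set for almost every `p`, because translations
preserve null sets. -/
lemma diffQuot_ae_eq {Ω A : Set (Heis n)} (hΩ : IsOpen Ω) (hA : IsOpen A) (hAΩ : A ⊆ Ω)
    {f F : Heis n → ℝ} (hFf : F =ᵐ[volume.restrict Ω] f) {w : Heis n} {ε : ℝ}
    (hmem : ∀ p ∈ A, mul p (dil ε w) ∈ Ω) :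
    diffQuot f w ε =ᵐ[volume.restrict A] fun p => ε⁻¹ * (F (mul p (dil ε w)) - F p) := by
  rw [EventuallyEq, ae_restrict_iff' hΩ.measurableSet] at hFf
  rw [EventuallyEq, ae_restrict_iff' hA.measurableSet]
  filter_upwards [hFf, (measurePreserving_mul_right (dil ε w)).quasiMeasurePreserving.ae hFf]
    with p h1 h2 hp
  rw [h1 (hAΩ hp), h2 (hmem p hp), diffQuot, div_eq_inv_mul]

end Heisenberg

end

/-! ### Assembly of the theorem -/

open Heisenberg in
theorem mainTheorem5 (n : ℕ) (hn : 1 ≤ n) (s : ℝ≥0∞) (hs : 1 ≤ s) (hs' : s ≠ ∞)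
    (Ω : Set (Heisenberg.Heis n)) (hΩ : IsOpen Ω)
    (f : Heisenberg.Heis n → ℝ) (hf : Heisenberg.MemHorizontalSobolev s Ω f)
    (gradf : Heisenberg.Heis n → Heisenberg.Hor n)
    (hgradf : Heisenberg.IsWeakHorizontalGradient Ω f gradf)
    (A : Set (Heisenberg.Heis n)) (hA : IsOpen A) (hAΩ : A ⊆ Ω)
    (hdist : 0 < Heisenberg.ccSetDist A (frontier Ω)) :
    (∀ w : Heisenberg.Heis n,
      MemLp (fun p => inner ℝ (gradf p) w.1) s (volume.restrict A) ∧
      Tendsto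
        (fun ε : ℝ => eLpNorm
          (fun p => Heisenberg.diffQuot f w ε p - inner ℝ (gradf p) w.1) s (volume.restrict A))
        (𝓝[>] 0) (𝓝 0)) ∧
    (∀ (w : Heisenberg.Heis n) (ε : ℝ), 0 < ε →
      ENNReal.ofReal (ε * (‖w.1‖ + 2 * √|w.2|)) < Heisenberg.ccSetDist A (frontier Ω) →
      (∀ p ∈ A, Heisenberg.mul p (Heisenberg.dil ε w) ∈ Ω) ∧
      MemLp (Heisenberg.diffQuot f w ε) s (volume.restrict A) ∧
      eLpNorm (Heisenberg.diffQuot f w ε) s (volume.restrict A) ≤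
        ENNReal.ofReal (‖w.1‖ + 2 * √|w.2|) * eLpNorm gradf s (volume.restrict Ω)) := by
  have hgL : MemLp gradf s (volume.restrict Ω) := memLp_of_isWeakHorizontalGradient hΩ hf hgradf
  -- Extension by zero followed by a measurable representative gives functions in `L^s` of the whole
  -- space. A jump across `∂Ω` does no harm, since the paths used stay in `Ω`.
  have hfi : MemLp (Ω.indicator f) s volume :=
    (memLp_indicator_iff_restrict hΩ.measurableSet).2 hf.1
  have hgi : MemLp (Ω.indicator gradf) s volume :=
    (memLp_indicator_iff_restrict hΩ.measurableSet).2 hgL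
  obtain ⟨F, hFm, hFae⟩ := hfi.1
  obtain ⟨G, hGm, hGae⟩ := hgi.1
  replace hFm := hFm.measurable
  replace hGm := hGm.measurable
  have hF : MemLp F s volume := hfi.ae_eq hFae
  have hG : MemLp G s volume := hgi.ae_eq hGae
  have hFf : F =ᵐ[volume.restrict Ω] f :=
    EventuallyEq.trans (ae_restrict_of_ae hFae.symm) (indicator_ae_eq_restrict hΩ.measurableSet)
  have hGg : G =ᵐ[volume.restrict Ω] gradf :=
    EventuallyEq.trans (ae_restrict_of_ae hGae.symm) (indicator_ae_eq_restrict hΩ.measurableSet)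
  have hGA : G =ᵐ[volume.restrict A] gradf := ae_restrict_of_ae_restrict_of_subset hAΩ hGg
  have hw := isWeakDirDeriv_of_isWeakHorizontalGradient hs hgradf hF hG hFf hGg
  have hpath : ∀ (w : Heis n) (l : List (Hor n)), (l.map fun v => ‖v‖).sum = ‖w.1‖ + 2 * √|w.2| →
      ∀ ε > 0, ENNReal.ofReal (ε * (‖w.1‖ + 2 * √|w.2|)) < ccSetDist A (frontier Ω) →
      ∀ p ∈ A, PathIn Ω (l.map fun v => ε • v) p := fun w l hl ε hε hlt =>
    pathIn_of_lt_ccSetDist hAΩ (by rwa [sum_norm_map_smul hε, hl])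
  have hend : ∀ (w : Heis n) (l : List (Hor n)), endpoint l = w → ∀ ε : ℝ,
      (∀ p ∈ A, PathIn Ω (l.map fun v => ε • v) p) → ∀ p ∈ A, mul p (dil ε w) ∈ Ω := by
    rintro w l rfl ε h p hp
    rw [← endpoint_map_smul]
    exact (h p hp).end_mem
  refine ⟨fun w => ⟨memLp_inner (hgL.mono_measure (Measure.restrict_mono hAΩ le_rfl)) _, ?_⟩,
    fun w ε hε hlt => ?_⟩
  · obtain ⟨l, hlw, hsum, hlen⟩ := exists_endpoint_eq hn w
    obtain ⟨ω, hω, hle⟩ := exists_modulus_of_pathIn hs hs' hFm hGm hF hG hw l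
    -- The rescaled path has length tending to zero, so it is eventually shorter than the positive
    -- distance to `∂Ω`.
    have hsmall : ∀ᶠ ε : ℝ in 𝓝[>] 0,
        ENNReal.ofReal (ε * (‖w.1‖ + 2 * √|w.2|)) < ccSetDist A (frontier Ω) := by
      have : Continuous fun ε : ℝ => ENNReal.ofReal (ε * (‖w.1‖ + 2 * √|w.2|)) :=
        ENNReal.continuous_ofReal.comp (by fun_prop)
      refine ((this.tendsto 0).mono_left nhdsWithin_le_nhds).eventually_lt_const ?_
      simpa using hdist
    refine tendsto_of_tendsto_of_tendsto_of_le_of_le' tendsto_const_nhds hω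
      (Eventually.of_forall fun _ => zero_le) ?_
    filter_upwards [hsmall, self_mem_nhdsWithin] with ε hlt hε
    have hP := hpath w l hlen ε hε hlt
    refine le_trans (le_of_eq (eLpNorm_congr_ae ?_)) (hle ε hε A hA hP)
    filter_upwards [diffQuot_ae_eq hΩ hA hAΩ hFf (hend w l hlw ε hP), hGA] with p h1 h2
    rw [h1, h2, endpoint_map_smul, hlw, hsum]
  · obtain ⟨l, hlw, hsum, hlen⟩ := exists_endpoint_eq hn w
    have hP := hpath w l hlen ε hε hlt
    have hmem := hend w l hlw ε hP
    have hae := diffQuot_ae_eq hΩ hA hAΩ hFf hmem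
    have hML : MemLp (fun p => ε⁻¹ * (F (mul p (dil ε w)) - F p)) s (volume.restrict A) :=
      (((hF.comp_measurePreserving (measurePreserving_mul_right (dil ε w))).sub hF).const_mul
        ε⁻¹).restrict A
    refine ⟨hmem, hML.ae_eq hae.symm, ?_⟩
    -- The dilated path has `ε` times the original length; this factor cancels the `ε⁻¹` of the
    -- quotient.
    have hest := eLpNorm_sub_le_of_pathIn hs hs' hΩ hFm hGm hF hG hw _ A hA hP
    rw [sum_norm_map_smul hε, endpoint_map_smul, hlw, hlen, eLpNorm_congr_ae hGg,
      ENNReal.ofReal_mul hε.le] at hest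
    rw [eLpNorm_congr_ae hae]
    have hsm : eLpNorm (fun p => ε⁻¹ * (F (mul p (dil ε w)) - F p)) s (volume.restrict A) =
        ENNReal.ofReal ε⁻¹ * eLpNorm (fun p => F (mul p (dil ε w)) - F p) s (volume.restrict A) := by
      have := eLpNorm_const_smul (p := s) (μ := volume.restrict A) ε⁻¹
        (fun p => F (mul p (dil ε w)) - F p)
      rw [Real.enorm_of_nonneg (inv_nonneg.2 hε.le)] at this
      exact this
    rw [hsm]
    refine (mul_le_mul_right hest _).trans (le_of_eq ?_)
    rw [← mul_assoc, ← mul_assoc, ← ENNReal.ofReal_mul (inv_nonneg.2 hε.le),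
      inv_mul_cancel₀ hε.ne', ENNReal.ofReal_one, one_mul]
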